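/- Conventions. For a (real) Riesz space $E$, $E^{\sim}$ denotes its order dual, i.e. the Riesz space of all order bounded linear functionals on $E$ (ordered by $f\le g$ iff $f(x)\le g(x)$ for all $x\ge 0$), $E^{\sim\sim}=(E^{\sim})^{\sim}$, and $J_E\colon E\to E^{\sim\sim}$ is $J_E(x)(x')=x'(x)$. An $m$-linear operator between Riesz spaces is positive if it maps tuples of positive elements to positive elements, and regular if it is a difference of two positive $m$-linear operators; $\mathcal L_r(E_1,\dots,E_m;F)$ is the space of regular $m$-linear operators (and $F$ is omitted when $F=\mathbb R$). A Riesz multimorphism is an operator $A\in\mathcal L_r(E_1,\dots,E_m;F)$ with $|A(x_1,\dots,x_m)|=A(|x_1|,\dots,|x_m|)$ for all $x_i\in E_i$. Let $\rho$ be a permutation of $\{1,\dots,m\}$. For $k\in\{1,\dots,m\}$ and $x''\in E_{\rho(k)}^{\sim\sim}$, the operator $\overline{x''}^{\rho}$ sends a regular multilinear form $B$ in the variables $x_i$, $i\notin\{\rho(1),\dots,\rho(k-1)\}$, to the regular multilinear form (a real number if $k=m$) in the variables $x_i$, $i\notin\{\rho(1),\dots,\rho(k)\}$, obtained by applying $x''$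 to the functional on $E_{\rho(k)}$ that $B$ defines when all variables other than $x_{\rho(k)}$ are fixed. The Arens extension $AR_m^\rho(A)\colon E_1^{\sim\sim}\times\cdots\times E_m^{\sim\sim}\to F^{\sim\sim}$ of $A\in\mathcal L_r(E_1,\dots,E_m;F)$ is the $m$-linear operator $$AR_m^\rho(A)(x_1'',\dots,x_m'')(y')=\big(\overline{x_{\rho(m)}''}^{\rho}\circ\cdots\circ\overline{x_{\rho(1)}''}^{\rho}\big)(y'\circ A),\qquad y'\in F^{\sim}.$$ Proposition. Let $m\in\mathbb N$, let $E_1,\dots,E_m,F$ be Riesz spaces, let $A\in\mathcal L_r(E_1,\dots,E_m;F)$ be a Riesz multimorphism and let $\rho$ be a permutation of $\{1,\dots,m\}$. For every $y'\in F^{\sim}$ that is a Riesz homomorphism $F\to\mathbb R$, the form $J_{F^{\sim}}(y')\circ AR_m^{\rho}(A)\colon E_1^{\sim\sim}\times\cdots\times E_m^{\sim\sim}\to\mathbb R$ is a Riesz multimorphism, and $$|AR_m^{\rho}(A)(x_1'',\dots,x_m'')|(y')=AR_m^{\rho}(A)(|x_1''|,\dots,|x_m''|)(y')$$ for all $x_1''\in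 E_1^{\sim\sim},\dots,x_m''\in E_m^{\sim\sim}$. -/

import Mathlib

set_option linter.unusedSectionVars false

noncomputable section RieszDefs

universe u v w

/-! A Riesz space is a real vector space `E` with a lattice order for which `+` and the
multiplication by nonnegative scalars are monotone:
`[AddCommGroup E] [Lattice E] [IsOrderedAddMonoid E] [Module ℝ E] [IsOrderedModule ℝ E]`. -/

section OrderDualSpace

variable (E : Type u) [AddCommGroup E] [Lattice E] [IsOrderedAddMonoid E]
  [Module ℝ E] [IsOrderedModule ℝ E]

/-- The linear functionals on `E` that are bounded on every order interval. -/
def orderBoundedFunctionals : Submodule ℝ (E →ₗ[ℝ] ℝ) where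
  carrier := {f | ∀ a b : E, ∃ M : ℝ, ∀ x ∈ Set.Icc a b, |f x| ≤ M}
  zero_mem' := fun a b => ⟨0, fun x _ => by simp⟩
  add_mem' := by
    intro f g hf hg a b
    obtain ⟨M, hM⟩ := hf a b
    obtain ⟨N, hN⟩ := hg a b
    exact ⟨M + N, fun x hx => (abs_add_le _ _).trans (add_le_add (hM x hx) (hN x hx))⟩
  smul_mem' := by
    intro c f hf a b
    obtain ⟨M, hM⟩ := hf a b
    refine ⟨|c| * M, fun x hx => ?_⟩
    simp only [LinearMap.smul_apply, smul_eq_mul, abs_mul]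
    exact mul_le_mul_of_nonneg_left (hM x hx) (abs_nonneg c)

/-- The order dual `E^~` of a Riesz space `E`. -/
def RieszDual : Type u := ↥(orderBoundedFunctionals E)

end OrderDualSpace

namespace RieszDual

section Basic

variable {E : Type u} [AddCommGroup E] [Lattice E] [IsOrderedAddMonoid E]
  [Module ℝ E] [IsOrderedModule ℝ E]

instance : AddCommGroup (RieszDual E) := inferInstanceAs (AddCommGroup ↥(orderBoundedFunctionals E))

instance : Module ℝ (RieszDual E) := inferInstanceAs (Module ℝ ↥(orderBoundedFunctionals E))

instance : FunLike (RieszDual E) E ℝ where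
  coe f := f.1
  coe_injective _ _ h := Subtype.ext (DFunLike.coe_injective h)

instance : LinearMapClass (RieszDual E) ℝ E ℝ where
  map_add f := f.1.map_add
  map_smulₛₗ f := f.1.map_smul

/-- The linear functional underlying an element of the order dual. -/
def toLinearMap (f : RieszDual E) : E →ₗ[ℝ] ℝ := f.1

theorem ext {f g : RieszDual E} (h : ∀ x, f x = g x) : f = g := DFunLike.ext f g h

theorem mk_apply (f : E →ₗ[ℝ] ℝ) (hf : f ∈ orderBoundedFunctionals E) (x : E) :
    (show RieszDual E from ⟨f, hf⟩) x = f x := rfl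

theorem toLinearMap_apply (f : RieszDual E) (x : E) : f.toLinearMap x = f x := rfl

theorem add_apply (f g : RieszDual E) (x : E) : (f + g) x = f x + g x := rfl

theorem sub_apply (f g : RieszDual E) (x : E) : (f - g) x = f x - g x := rfl

theorem neg_apply (f : RieszDual E) (x : E) : (-f) x = -f x := rfl

theorem zero_apply (x : E) : (0 : RieszDual E) x = 0 := rfl

theorem smul_apply (c : ℝ) (f : RieszDual E) (x : E) : (c • f) x = c * f x := rfl

theorem exists_bound (f : RieszDual E) (a b : E) : ∃ M : ℝ, ∀ x ∈ Set.Icc a b, |f x| ≤ M :=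
  f.2 a b

/-- The order of `E^~`: `f ≤ g` iff `f x ≤ g x` for all `x ≥ 0`. -/
instance : PartialOrder (RieszDual E) where
  le f g := ∀ x : E, 0 ≤ x → f x ≤ g x
  le_refl f x _ := le_refl _
  le_trans f g h h1 h2 x hx := (h1 x hx).trans (h2 x hx)
  le_antisymm f g h1 h2 := by
    refine ext fun x => ?_
    have hp := le_antisymm (h1 _ (posPart_nonneg x)) (h2 _ (posPart_nonneg x))
    have hn := le_antisymm (h1 _ (negPart_nonneg x)) (h2 _ (negPart_nonneg x))
    rw [← posPart_sub_negPart x, map_sub, map_sub, hp, hn]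

theorem le_def {f g : RieszDual E} : f ≤ g ↔ ∀ x : E, 0 ≤ x → f x ≤ g x := Iff.rfl

instance : IsOrderedAddMonoid (RieszDual E) where
  add_le_add_left f g h k x hx := by
    rw [add_apply, add_apply]
    have := h x hx
    linarith

instance : IsOrderedModule ℝ (RieszDual E) where
  smul_le_smul_of_nonneg_left c hc f g h x hx := by
    rw [smul_apply, smul_apply]
    exact mul_le_mul_of_nonneg_left (h x hx) hc
  smul_le_smul_of_nonneg_right f hf c d h x hx := by
    rw [smul_apply, smul_apply]
    exact mul_le_mul_of_nonneg_right h (hf x hx)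

/-- The positive part of a functional on the positive cone, by the Riesz-Kantorovich formula
`f⁺(x) = sup {f y : 0 ≤ y ≤ x}`. -/
def coneSup (f : RieszDual E) (x : E) : ℝ := sSup (f '' Set.Icc 0 x)

theorem coneSup_bddAbove (f : RieszDual E) (x : E) : BddAbove (f '' Set.Icc 0 x) := by
  obtain ⟨M, hM⟩ := f.exists_bound 0 x
  refine ⟨M, ?_⟩
  rintro _ ⟨y, hy, rfl⟩
  exact (le_abs_self _).trans (hM y hy)

theorem le_coneSup (f : RieszDual E) {x y : E} (h0 : 0 ≤ y) (h : y ≤ x) : f y ≤ f.coneSup x :=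
  le_csSup (f.coneSup_bddAbove x) ⟨y, ⟨h0, h⟩, rfl⟩

theorem coneSup_le (f : RieszDual E) {x : E} (hx : 0 ≤ x) {c : ℝ}
    (h : ∀ y, 0 ≤ y → y ≤ x → f y ≤ c) : f.coneSup x ≤ c := by
  refine csSup_le ⟨f 0, 0, ⟨le_refl _, hx⟩, rfl⟩ ?_
  rintro _ ⟨y, hy, rfl⟩
  exact h y hy.1 hy.2

theorem coneSup_nonneg (f : RieszDual E) {x : E} (hx : 0 ≤ x) : 0 ≤ f.coneSup x := by
  have := f.le_coneSup (le_refl (0 : E)) hx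
  rwa [map_zero] at this

theorem coneSup_add (f : RieszDual E) {x y : E} (hx : 0 ≤ x) (hy : 0 ≤ y) :
    f.coneSup (x + y) = f.coneSup x + f.coneSup y := by
  apply le_antisymm
  · refine f.coneSup_le (add_nonneg hx hy) fun z hz hzxy => ?_
    have h1 : f (z ⊓ x) ≤ f.coneSup x := f.le_coneSup (le_inf hz hx) inf_le_right
    have h2 : f (z - z ⊓ x) ≤ f.coneSup y := by
      refine f.le_coneSup (sub_nonneg.2 inf_le_left) ?_
      rw [sub_le_iff_le_add, add_inf]
      refine le_inf (le_add_of_nonneg_left hy) ?_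
      rwa [add_comm y x]
    rw [map_sub] at h2
    linarith
  · have key : ∀ a, 0 ≤ a → a ≤ x → f.coneSup y ≤ f.coneSup (x + y) - f a := by
      intro a ha hax
      refine f.coneSup_le hy fun b hb hby => ?_
      have := f.le_coneSup (add_nonneg ha hb) (add_le_add hax hby)
      rw [map_add] at this
      linarith
    have : f.coneSup x ≤ f.coneSup (x + y) - f.coneSup y :=
      f.coneSup_le hx fun a ha hax => by linarith [key a ha hax]
    linarith

theorem coneSup_smul_le (f : RieszDual E) {c : ℝ} (hc : 0 < c) {x : E} (hx : 0 ≤ x) :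
    f.coneSup (c • x) ≤ c * f.coneSup x := by
  refine f.coneSup_le (smul_nonneg hc.le hx) fun y hy hyx => ?_
  have h1 : f (c⁻¹ • y) ≤ f.coneSup x := by
    refine f.le_coneSup (smul_nonneg (inv_nonneg.2 hc.le) hy) ?_
    have := smul_le_smul_of_nonneg_left hyx (inv_nonneg.2 hc.le)
    rwa [inv_smul_smul₀ hc.ne'] at this
  have h2 := mul_le_mul_of_nonneg_left h1 hc.le
  rw [map_smul, smul_eq_mul, mul_inv_cancel_left₀ hc.ne'] at h2
  exact h2

theorem coneSup_smul (f : RieszDual E) {c : ℝ} (hc : 0 ≤ c) {x : E} (hx : 0 ≤ x) :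
    f.coneSup (c • x) = c * f.coneSup x := by
  rcases hc.eq_or_lt with rfl | hc
  · rw [zero_smul, zero_mul]
    have := f.coneSup_add (le_refl (0 : E)) (le_refl 0)
    rw [add_zero] at this
    linarith
  · refine le_antisymm (f.coneSup_smul_le hc hx) ?_
    have h := f.coneSup_smul_le (inv_pos.2 hc) (smul_nonneg hc.le hx)
    rw [inv_smul_smul₀ hc.ne'] at h
    have h2 := mul_le_mul_of_nonneg_left h hc.le
    rwa [mul_inv_cancel_left₀ hc.ne'] at h2

theorem coneSup_sub_eq (f : RieszDual E) {x a b : E} (ha : 0 ≤ a) (hb : 0 ≤ b) (h : x = a - b) :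
    f.coneSup x⁺ - f.coneSup x⁻ = f.coneSup a - f.coneSup b := by
  have h1 : x⁺ + b = a + x⁻ := by
    have h2 := posPart_sub_negPart x
    rw [h] at h2 ⊢
    rw [sub_eq_sub_iff_add_eq_add] at h2
    exact h2
  have h3 := f.coneSup_add (posPart_nonneg x) hb
  rw [h1, f.coneSup_add ha (negPart_nonneg x)] at h3
  linarith

/-- The linear extension of `coneSup f` to the whole space. -/
def posLin (f : RieszDual E) : E →ₗ[ℝ] ℝ where
  toFun x := f.coneSup x⁺ - f.coneSup x⁻
  map_add' x y := by
    rw [f.coneSup_sub_eq (add_nonneg (posPart_nonneg x) (posPart_nonneg y))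
      (add_nonneg (negPart_nonneg x) (negPart_nonneg y)) (x := x + y),
      f.coneSup_add (posPart_nonneg x) (posPart_nonneg y),
      f.coneSup_add (negPart_nonneg x) (negPart_nonneg y)]
    · ring
    · rw [add_sub_add_comm, posPart_sub_negPart, posPart_sub_negPart]
  map_smul' c x := by
    rcases le_total 0 c with hc | hc
    · rw [f.coneSup_sub_eq (smul_nonneg hc (posPart_nonneg x)) (smul_nonneg hc (negPart_nonneg x))
        (x := c • x), f.coneSup_smul hc (posPart_nonneg x), f.coneSup_smul hc (negPart_nonneg x)]
      · simp only [RingHom.id_apply, smul_eq_mul]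
        ring
      · rw [← smul_sub, posPart_sub_negPart]
    · have hc' : 0 ≤ -c := neg_nonneg.2 hc
      rw [f.coneSup_sub_eq (smul_nonneg hc' (negPart_nonneg x))
        (smul_nonneg hc' (posPart_nonneg x)) (x := c • x), f.coneSup_smul hc' (posPart_nonneg x),
        f.coneSup_smul hc' (negPart_nonneg x)]
      · simp only [RingHom.id_apply, smul_eq_mul]
        ring
      · rw [← smul_sub, neg_smul, ← smul_neg, neg_sub, posPart_sub_negPart]

theorem posLin_apply_of_nonneg (f : RieszDual E) {x : E} (hx : 0 ≤ x) :
    f.posLin x = f.coneSup x := by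
  have h0 : f.coneSup (0 : E) = 0 := by
    simpa using f.coneSup_smul (le_refl (0 : ℝ)) (le_refl (0 : E))
  change f.coneSup x⁺ - f.coneSup x⁻ = _
  rw [posPart_of_nonneg hx, negPart_of_nonneg hx, h0, sub_zero]

theorem mem_of_nonneg {g : E →ₗ[ℝ] ℝ} (hg : ∀ x, 0 ≤ x → 0 ≤ g x) :
    g ∈ orderBoundedFunctionals E := by
  intro a b
  refine ⟨|g a| + |g b|, fun x hx => ?_⟩
  have h1 : 0 ≤ g (x - a) := hg _ (sub_nonneg.2 hx.1)
  have h2 : 0 ≤ g (b - x) := hg _ (sub_nonneg.2 hx.2)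
  rw [map_sub] at h1 h2
  rw [abs_le]
  constructor
  · linarith [neg_abs_le (g a), abs_nonneg (g b)]
  · linarith [le_abs_self (g b), abs_nonneg (g a)]

/-- `f ⊔ 0` in the order dual. -/
def pos (f : RieszDual E) : RieszDual E :=
  ⟨f.posLin, mem_of_nonneg fun x hx => by
    rw [f.posLin_apply_of_nonneg hx]
    exact f.coneSup_nonneg hx⟩

theorem pos_apply (f : RieszDual E) {x : E} (hx : 0 ≤ x) : f.pos x = f.coneSup x :=
  f.posLin_apply_of_nonneg hx

theorem pos_nonneg (f : RieszDual E) : 0 ≤ f.pos := fun x hx => by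
  rw [f.pos_apply hx]
  exact f.coneSup_nonneg hx

theorem le_pos (f : RieszDual E) : f ≤ f.pos := fun x hx => by
  rw [f.pos_apply hx]
  exact f.le_coneSup hx (le_refl x)

theorem pos_le {f g : RieszDual E} (h0 : 0 ≤ g) (h : f ≤ g) : f.pos ≤ g := fun x hx => by
  rw [f.pos_apply hx]
  refine f.coneSup_le hx fun y hy hyx => (h y hy).trans ?_
  have h1 : 0 ≤ g (x - y) := h0 (x - y) (sub_nonneg.2 hyx)
  rw [map_sub] at h1
  exact sub_nonneg.1 h1

/-- The order dual is a lattice (for the order defined above). -/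
instance : Lattice (RieszDual E) where
  sup f g := (f - g).pos + g
  inf f g := f - (f - g).pos
  le_sup_left f g := by
    have := (f - g).le_pos
    exact sub_le_iff_le_add.1 this
  le_sup_right f g := le_add_of_nonneg_left (f - g).pos_nonneg
  sup_le f g h hf hg := by
    have : (f - g).pos ≤ h - g := pos_le (sub_nonneg.2 hg) (sub_le_sub_right hf g)
    exact le_sub_iff_add_le.1 this
  inf_le_left f g := sub_le_self _ (f - g).pos_nonneg
  inf_le_right f g := by
    have := (f - g).le_pos
    exact sub_le_comm.1 this
  le_inf f g h hg hh := by
    have : (g - h).pos ≤ g - f := pos_le (sub_nonneg.2 hg) (sub_le_sub_left hh g)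
    exact le_sub_comm.1 this

/-- The canonical operator `J_E : E → E^~~`, `J_E(x)(f) = f(x)`. -/
def canonicalMap : E →ₗ[ℝ] RieszDual (RieszDual E) where
  toFun x := ⟨{ toFun := fun f => f x
                map_add' := fun _ _ => rfl
                map_smul' := fun _ _ => rfl }, by
    intro f g
    refine ⟨|f x⁺| + |g x⁺| + (|f x⁻| + |g x⁻|), fun h hh => ?_⟩
    have key : ∀ y : E, 0 ≤ y → |h y| ≤ |f y| + |g y| := fun y hy => by
      have h1 := hh.1 y hy
      have h2 := hh.2 y hy
      rw [abs_le]
      constructor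
      · linarith [neg_abs_le (f y), abs_nonneg (g y)]
      · linarith [le_abs_self (g y), abs_nonneg (f y)]
    have h1 := key _ (posPart_nonneg x)
    have h2 := key _ (negPart_nonneg x)
    have h3 : h x = h x⁺ - h x⁻ := by rw [← map_sub, posPart_sub_negPart]
    change |h x| ≤ _
    rw [h3]
    exact (abs_sub _ _).trans (add_le_add h1 h2)⟩
  map_add' x y := ext fun f => map_add f x y
  map_smul' c x := ext fun f => map_smul f c x

theorem canonicalMap_apply (x : E) (f : RieszDual E) : canonicalMap x f = f x := rfl

end Basic

end RieszDual

/-- A Riesz homomorphism: a linear map that preserves the lattice operations. -/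
def IsRieszHom {E : Type u} {F : Type v} [AddCommGroup E] [Lattice E] [Module ℝ E]
    [AddCommGroup F] [Lattice F] [Module ℝ F] (f : E →ₗ[ℝ] F) : Prop :=
  (∀ x y, f (x ⊔ y) = f x ⊔ f y) ∧ ∀ x y, f (x ⊓ y) = f x ⊓ f y

section Multilinear

variable {ι : Type w} {E : ι → Type u} {F : Type v}
  [∀ i, AddCommGroup (E i)] [∀ i, Lattice (E i)] [∀ i, IsOrderedAddMonoid (E i)]
  [∀ i, Module ℝ (E i)] [∀ i, IsOrderedModule ℝ (E i)]
  [AddCommGroup F] [Lattice F] [IsOrderedAddMonoid F] [Module ℝ F] [IsOrderedModule ℝ F]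

/-- A positive multilinear operator: it maps tuples of positive elements to positive elements. -/
def IsPositiveMultilinear (A : MultilinearMap ℝ E F) : Prop :=
  ∀ x, (∀ i, 0 ≤ x i) → 0 ≤ A x

/-- A regular multilinear operator: the difference of two positive ones. -/
def IsRegularMultilinear (A : MultilinearMap ℝ E F) : Prop :=
  ∃ A₁ A₂ : MultilinearMap ℝ E F,
    IsPositiveMultilinear A₁ ∧ IsPositiveMultilinear A₂ ∧ A = A₁ - A₂

/-- A Riesz multimorphism: a regular multilinear operator `A` with
`|A (x_1, …, x_m)| = A (|x_1|, …, |x_m|)`. -/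
def IsRieszMultimorphism (A : MultilinearMap ℝ E F) : Prop :=
  IsRegularMultilinear A ∧ ∀ x, |A x| = A fun i => |x i|

theorem IsPositiveMultilinear.isRegular {A : MultilinearMap ℝ E F} (hA : IsPositiveMultilinear A) :
    IsRegularMultilinear A :=
  ⟨A, 0, hA, fun _ _ => le_refl _, (sub_zero A).symm⟩

theorem IsPositiveMultilinear.add {A B : MultilinearMap ℝ E F} (hA : IsPositiveMultilinear A)
    (hB : IsPositiveMultilinear B) : IsPositiveMultilinear (A + B) := fun x hx => by
  rw [_root_.add_apply]
  exact add_nonneg (hA x hx) (hB x hx)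

variable (E F) in
/-- The space `L_r(E_1, …, E_m; F)` of regular multilinear operators. -/
def RegularMultilinear : Submodule ℝ (MultilinearMap ℝ E F) where
  carrier := {A | IsRegularMultilinear A}
  zero_mem' := IsPositiveMultilinear.isRegular fun _ _ => le_refl _
  add_mem' := by
    rintro _ _ ⟨A₁, A₂, h1, h2, rfl⟩ ⟨B₁, B₂, h3, h4, rfl⟩
    exact ⟨A₁ + B₁, A₂ + B₂, h1.add h3, h2.add h4, by abel⟩
  smul_mem' := by
    rintro c _ ⟨A₁, A₂, h1, h2, rfl⟩
    rcases le_total 0 c with hc | hc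
    · exact ⟨c • A₁, c • A₂, fun x hx => smul_nonneg hc (h1 x hx),
        fun x hx => smul_nonneg hc (h2 x hx), smul_sub c A₁ A₂⟩
    · have hc' : 0 ≤ -c := neg_nonneg.2 hc
      refine ⟨(-c) • A₂, (-c) • A₁, fun x hx => smul_nonneg hc' (h2 x hx),
        fun x hx => smul_nonneg hc' (h1 x hx), ?_⟩
      rw [← smul_sub, neg_smul, ← smul_neg, neg_sub]

theorem IsPositiveMultilinear.abs_le [Fintype ι] {A : MultilinearMap ℝ E ℝ}
    (hA : IsPositiveMultilinear A) (x : ∀ i, E i) : |A x| ≤ A fun i => |x i| := by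
  classical
  suffices h : ∀ s : Finset ι, ∀ x : ∀ i, E i, (∀ i, i ∉ s → 0 ≤ x i) →
      |A x| ≤ A fun i => |x i| from
    h Finset.univ x fun i hi => absurd (Finset.mem_univ i) hi
  intro s
  induction s using Finset.induction_on with
  | empty =>
    intro x hx
    have hx0 : ∀ i, 0 ≤ x i := fun i => hx i (Finset.notMem_empty i)
    rw [abs_of_nonneg (hA x hx0)]
    exact le_of_eq (congrArg A (funext fun i => (abs_of_nonneg (hx0 i)).symm))
  | insert j s hj ih =>
    intro x hx
    have hup : ∀ v : E j, 0 ≤ v →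
        |A (Function.update x j v)| ≤ A (Function.update (fun i => |x i|) j v) := by
      intro v hv
      have h1 := ih (Function.update x j v) (by
        intro i hi
        rcases eq_or_ne i j with rfl | hij
        · rwa [Function.update_self]
        · rw [Function.update_of_ne hij]
          exact hx i (by simp [hij, hi]))
      have h2 : (fun i => |Function.update x j v i|) = Function.update (fun i => |x i|) j v := by
        funext i
        rcases eq_or_ne i j with rfl | hij
        · rw [Function.update_self, Function.update_self, abs_of_nonneg hv]
        · rw [Function.update_of_ne hij, Function.update_of_ne hij]
      rwa [h2] at h1
    have h1 : A x = A (Function.update x j (x j)⁺) - A (Function.update x j (x j)⁻) := by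
      rw [← MultilinearMap.map_update_sub, posPart_sub_negPart, Function.update_eq_self]
    have h2 : (A fun i => |x i|) = A (Function.update (fun i => |x i|) j (x j)⁺)
        + A (Function.update (fun i => |x i|) j (x j)⁻) := by
      rw [← MultilinearMap.map_update_add, posPart_add_negPart]
      exact congrArg A (Function.update_eq_self j (fun i => |x i|)).symm
    rw [h1, h2]
    exact (abs_sub _ _).trans
      (add_le_add (hup _ (posPart_nonneg _)) (hup _ (negPart_nonneg _)))

variable (E F) in
/-- `y' ∘ A` for `y'` in the order dual of `F` and a regular operator `A`, linear in `y'`. -/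
def dualComp (A : RegularMultilinear E F) : RieszDual F →ₗ[ℝ] RegularMultilinear E ℝ where
  toFun y := ⟨y.toLinearMap.compMultilinearMap A.1, by
    obtain ⟨A₁, A₂, h1, h2, h⟩ := A.2
    have hy : y = y⁺ - y⁻ := (posPart_sub_negPart y).symm
    have hp : ∀ (z : RieszDual F) (B : MultilinearMap ℝ E F), 0 ≤ z → IsPositiveMultilinear B →
        IsPositiveMultilinear (z.toLinearMap.compMultilinearMap B) :=
      fun z B hz hB x hx => hz _ (hB x hx)
    refine ⟨y⁺.toLinearMap.compMultilinearMap A₁ + y⁻.toLinearMap.compMultilinearMap A₂,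
      y⁺.toLinearMap.compMultilinearMap A₂ + y⁻.toLinearMap.compMultilinearMap A₁,
      (hp _ _ (posPart_nonneg y) h1).add (hp _ _ (negPart_nonneg y) h2),
      (hp _ _ (posPart_nonneg y) h2).add (hp _ _ (negPart_nonneg y) h1), ?_⟩
    rw [h]
    ext x
    simp only [LinearMap.compMultilinearMap_apply, _root_.add_apply,
      _root_.sub_apply, RieszDual.toLinearMap_apply]
    have hyx : ∀ v : F, y v = y⁺ v - y⁻ v := fun v => by
      rw [← RieszDual.sub_apply, posPart_sub_negPart]
    rw [hyx, map_sub, map_sub]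
    ring⟩
  map_add' _ _ := rfl
  map_smul' _ _ := rfl

/-- The form `(y_k)_k ↦ B ((x_i)_i)` with `x_{ρ(k)} = y_k`: the variables of `B` listed in the
order `ρ(1), …, ρ(m)`. -/
def permuteForm (ρ : Equiv.Perm ι) :
    RegularMultilinear E ℝ →ₗ[ℝ] RegularMultilinear (fun k => E (ρ k)) ℝ where
  toFun B := ⟨MultilinearMap.domDomCongrLinearEquiv' ℝ ℝ E ℝ ρ.symm B.1, by
    obtain ⟨B₁, B₂, h1, h2, h⟩ := B.2
    have hp : ∀ C : MultilinearMap ℝ E ℝ, IsPositiveMultilinear C → IsPositiveMultilinear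
        (E := fun k => E (ρ k)) (MultilinearMap.domDomCongrLinearEquiv' ℝ ℝ E ℝ ρ.symm C) := by
      intro C hC x hx
      refine hC _ fun i => ?_
      obtain ⟨k, rfl⟩ := ρ.surjective i
      have : (Equiv.piCongrLeft' E ρ.symm).symm x (ρ k) = x k := by
        have h3 := congrFun ((Equiv.piCongrLeft' E ρ.symm).apply_symm_apply x) k
        exact h3
      rw [this]
      exact hx k
    exact ⟨_, _, hp B₁ h1, hp B₂ h2, by rw [h, map_sub]⟩⟩
  map_add' B C := Subtype.ext (map_add _ B.1 C.1)
  map_smul' c B := Subtype.ext (map_smul _ c B.1)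

theorem permuteForm_apply (ρ : Equiv.Perm ι) (B : RegularMultilinear E ℝ) (x : ∀ i, E i) :
    (permuteForm ρ B).1 (fun k => x (ρ k)) = B.1 x :=
  congrArg B.1 ((Equiv.piCongrLeft' E ρ.symm).symm_apply_apply x)

end Multilinear

section Arens

variable {n : ℕ} {E : Fin (n + 1) → Type u}
  [∀ i, AddCommGroup (E i)] [∀ i, Lattice (E i)] [∀ i, IsOrderedAddMonoid (E i)]
  [∀ i, Module ℝ (E i)] [∀ i, IsOrderedModule ℝ (E i)]

/-- The linear functional `t ↦ C(t, y)`. -/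
def partialLin (C : MultilinearMap ℝ E ℝ) (y : ∀ i : Fin n, E i.succ) : E 0 →ₗ[ℝ] ℝ where
  toFun t := C (Fin.cons t y)
  map_add' t s := C.cons_add y t s
  map_smul' c t := C.cons_smul y c t

theorem partialForm_mem (B : RegularMultilinear E ℝ) (y : ∀ i : Fin n, E i.succ) :
    partialLin B.1 y ∈ orderBoundedFunctionals (E 0) := by
  obtain ⟨B₁, B₂, h1, h2, h⟩ := B.2
  have key : ∀ C : MultilinearMap ℝ E ℝ, IsPositiveMultilinear C →
      partialLin C y ∈ orderBoundedFunctionals (E 0) := by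
    intro C hC a b
    refine ⟨C (Fin.cons (|a| + |b|) fun i => |y i|), fun t ht => ?_⟩
    have ht' : |t| ≤ |a| + |b| := by
      refine abs_le'.2 ⟨?_, ?_⟩
      · exact ht.2.trans ((le_abs_self b).trans (le_add_of_nonneg_left (abs_nonneg a)))
      · exact (neg_le_neg ht.1).trans
          ((neg_le_abs a).trans (le_add_of_nonneg_right (abs_nonneg b)))
    have h3 := hC.abs_le (Fin.cons t y)
    have h4 : (fun i => |(Fin.cons t y : ∀ i, E i) i|)
        = Fin.cons (α := E) |t| (fun i => |y i|) := by
      funext i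
      refine Fin.cases ?_ (fun j => ?_) i <;> simp
    rw [h4] at h3
    have h5 : 0 ≤ C (Fin.cons (|a| + |b| - |t|) fun i => |y i|) := by
      refine hC _ fun i => ?_
      refine Fin.cases ?_ (fun j => ?_) i
      · simpa using ht'
      · simp
    have h6 : C (Fin.cons (|a| + |b| - |t|) fun i => |y i|)
        = C (Fin.cons (|a| + |b|) fun i => |y i|) - C (Fin.cons |t| fun i => |y i|) :=
      (partialLin C fun i => |y i|).map_sub (|a| + |b|) |t|
    rw [h6] at h5
    exact h3.trans (sub_nonneg.1 h5)
  have h3 : partialLin B.1 y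
      = partialLin B₁ y - partialLin B₂ y := by
    rw [h]
    rfl
  rw [h3]
  exact Submodule.sub_mem _ (key B₁ h1) (key B₂ h2)

/-- The functional `B(• ; y)` on the space of the first variable, associated to a regular form `B`
and values `y` of the remaining variables. -/
def partialForm (B : RegularMultilinear E ℝ) :
    MultilinearMap ℝ (fun i : Fin n => E i.succ) (RieszDual (E 0)) where
  toFun y := ⟨partialLin B.1 y, partialForm_mem B y⟩
  map_update_add' y i v w :=
    RieszDual.ext fun t => (B.1.curryLeft t).map_update_add y i v w
  map_update_smul' y i c v :=
    RieszDual.ext fun t => (B.1.curryLeft t).map_update_smul y i c v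

theorem partialForm_apply (B : RegularMultilinear E ℝ) (y : ∀ i : Fin n, E i.succ) (t : E 0) :
    partialForm B y t = B.1 (Fin.cons t y) := rfl

/-- The operator `x̄''` from `L_r(E_1, …, E_m)` to `L_r(E_2, …, E_m)`, for `x''` in the second order
dual of the space of the first variable: `x̄''(B)(y) = x''(B(• ; y))`. It is linear in `x''`
and in `B`. -/
def barOperator : RieszDual (RieszDual (E 0)) →ₗ[ℝ] RegularMultilinear E ℝ →ₗ[ℝ]
    RegularMultilinear (fun i : Fin n => E i.succ) ℝ :=
  LinearMap.mk₂ ℝ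
    (fun x'' B => ⟨x''.toLinearMap.compMultilinearMap (partialForm B), by
      obtain ⟨B₁, B₂, h1, h2, h⟩ := B.2
      have hp : ∀ (z : RieszDual (RieszDual (E 0))) (C : MultilinearMap ℝ E ℝ)
          (hC : IsPositiveMultilinear C), 0 ≤ z → IsPositiveMultilinear
          (z.toLinearMap.compMultilinearMap (partialForm ⟨C, hC.isRegular⟩)) := by
        intro z C hC hz y hy
        refine hz _ fun t ht => hC (Fin.cons t y) fun i => ?_
        refine Fin.cases ?_ (fun j => ?_) i
        · exact ht
        · exact hy j
      have hB : ∀ y, partialForm B y = partialForm ⟨B₁, h1.isRegular⟩ y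
          - partialForm ⟨B₂, h2.isRegular⟩ y := by
        intro y
        refine RieszDual.ext fun t => ?_
        rw [RieszDual.sub_apply, partialForm_apply, h]
        rfl
      have hx : ∀ v, x'' v = x''⁺ v - x''⁻ v := fun v => by
        rw [← RieszDual.sub_apply, posPart_sub_negPart]
      refine ⟨_, _,
        (hp _ _ h1 (posPart_nonneg x'')).add (hp _ _ h2 (negPart_nonneg x'')),
        (hp _ _ h2 (posPart_nonneg x'')).add (hp _ _ h1 (negPart_nonneg x'')), ?_⟩
      ext y
      simp only [LinearMap.compMultilinearMap_apply, _root_.add_apply,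
        _root_.sub_apply, RieszDual.toLinearMap_apply]
      rw [hB, hx, map_sub, map_sub]
      ring⟩)
    (fun _ _ _ => rfl)
    (fun _ _ _ => rfl)
    (fun x'' B C => Subtype.ext (MultilinearMap.ext fun y =>
      x''.toLinearMap.map_add (partialForm B y) (partialForm C y)))
    (fun c x'' B => Subtype.ext (MultilinearMap.ext fun y =>
      x''.toLinearMap.map_smul c (partialForm B y)))

theorem barOperator_apply (x'' : RieszDual (RieszDual (E 0))) (B : RegularMultilinear E ℝ)
    (y : ∀ i : Fin n, E i.succ) : (barOperator x'' B).1 y = x'' (partialForm B y) := rfl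

theorem barOperator_nonneg {x'' : RieszDual (RieszDual (E 0))} (hx : 0 ≤ x'')
    {B : RegularMultilinear E ℝ} (hB : IsPositiveMultilinear B.1) :
    IsPositiveMultilinear (barOperator x'' B).1 := by
  intro y hy
  refine hx _ fun t ht => hB (Fin.cons t y) fun i => ?_
  refine Fin.cases ?_ (fun j => ?_) i
  · exact ht
  · exact hy j

end Arens

/-- The composition of bar operators `(x̄_m'' ∘ ⋯ ∘ x̄_1'') (B)`, for a regular form `B`; it is
linear in `B` and multilinear in `(x_1'', …, x_m'')`. -/
def barIterate : (n : ℕ) → (E : Fin n → Type u) →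
    [∀ i, AddCommGroup (E i)] → [∀ i, Lattice (E i)] → [∀ i, IsOrderedAddMonoid (E i)] →
    [∀ i, Module ℝ (E i)] → [∀ i, IsOrderedModule ℝ (E i)] →
    RegularMultilinear E ℝ →ₗ[ℝ] MultilinearMap ℝ (fun i => RieszDual (RieszDual (E i))) ℝ
  | 0, _, _, _, _, _, _ =>
    { toFun := fun B => MultilinearMap.constOfIsEmpty ℝ _ (B.1 fun i => i.elim0)
      map_add' := fun _ _ => rfl
      map_smul' := fun _ _ => rfl }
  | n + 1, E, _, _, _, _, _ =>
    { toFun := fun B =>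
        ((barIterate n fun i => E i.succ).comp ((barOperator (E := E)).flip B)).uncurryLeft
      map_add' := fun B C => by
        ext x
        simp
      map_smul' := fun c B => by
        ext x
        simp }

theorem barIterate_zero (E : Fin 0 → Type u)
    [∀ i, AddCommGroup (E i)] [∀ i, Lattice (E i)] [∀ i, IsOrderedAddMonoid (E i)]
    [∀ i, Module ℝ (E i)] [∀ i, IsOrderedModule ℝ (E i)] (B : RegularMultilinear E ℝ)
    (x'' : ∀ i, RieszDual (RieszDual (E i))) :
    barIterate 0 E B x'' = B.1 fun i => i.elim0 := rfl

theorem barIterate_succ {n : ℕ} (E : Fin (n + 1) → Type u)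
    [∀ i, AddCommGroup (E i)] [∀ i, Lattice (E i)] [∀ i, IsOrderedAddMonoid (E i)]
    [∀ i, Module ℝ (E i)] [∀ i, IsOrderedModule ℝ (E i)] (B : RegularMultilinear E ℝ)
    (x'' : ∀ i, RieszDual (RieszDual (E i))) :
    barIterate (n + 1) E B x''
      = barIterate n (fun i => E i.succ) (barOperator (x'' 0) B) (fun i => x'' i.succ) := rfl

theorem barIterate_regular (n : ℕ) (E : Fin n → Type u)
    [∀ i, AddCommGroup (E i)] [∀ i, Lattice (E i)] [∀ i, IsOrderedAddMonoid (E i)]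
    [∀ i, Module ℝ (E i)] [∀ i, IsOrderedModule ℝ (E i)]
    (x'' : ∀ i, RieszDual (RieszDual (E i))) :
    ∃ P N : RegularMultilinear E ℝ →ₗ[ℝ] ℝ,
      (∀ B : RegularMultilinear E ℝ, IsPositiveMultilinear B.1 → 0 ≤ P B ∧ 0 ≤ N B) ∧
      ∀ B, barIterate n E B x'' = P B - N B := by
  induction n with
  | zero =>
    refine ⟨{ toFun := fun B => barIterate 0 E B x''
              map_add' := fun _ _ => rfl
              map_smul' := fun _ _ => rfl }, 0, fun B hB => ⟨?_, le_refl _⟩, fun B => ?_⟩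
    · exact hB _ fun i => i.elim0
    · exact (sub_zero _).symm
  | succ n ih =>
    obtain ⟨P, N, hPN, h⟩ := ih (fun i => E i.succ) (fun i => x'' i.succ)
    refine ⟨P.comp (barOperator (x'' 0)⁺) + N.comp (barOperator (x'' 0)⁻),
      P.comp (barOperator (x'' 0)⁻) + N.comp (barOperator (x'' 0)⁺), fun B hB => ?_, fun B => ?_⟩
    · have h1 := hPN _ (barOperator_nonneg (posPart_nonneg (x'' 0)) hB)
      have h2 := hPN _ (barOperator_nonneg (negPart_nonneg (x'' 0)) hB)
      exact ⟨add_nonneg h1.1 h2.2, add_nonneg h2.1 h1.2⟩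
    · have h1 : barOperator (x'' 0) B
          = barOperator (x'' 0)⁺ B - barOperator (x'' 0)⁻ B := by
        refine Subtype.ext (MultilinearMap.ext fun y => ?_)
        change x'' 0 (partialForm B y) = (x'' 0)⁺ (partialForm B y) - (x'' 0)⁻ (partialForm B y)
        rw [← RieszDual.sub_apply, posPart_sub_negPart]
      have h2 : ∀ Q : RegularMultilinear (fun i : Fin n => E i.succ) ℝ →ₗ[ℝ] ℝ,
          Q (barOperator (x'' 0)⁺ B - barOperator (x'' 0)⁻ B)
            = Q (barOperator (x'' 0)⁺ B) - Q (barOperator (x'' 0)⁻ B) := fun Q => map_sub Q _ _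
      rw [barIterate_succ, h, h1, h2, h2]
      simp only [LinearMap.add_apply, LinearMap.comp_apply]
      ring

section ArensExtension

variable {m : ℕ} {E : Fin m → Type u} {F : Type v}
  [∀ i, AddCommGroup (E i)] [∀ i, Lattice (E i)] [∀ i, IsOrderedAddMonoid (E i)]
  [∀ i, Module ℝ (E i)] [∀ i, IsOrderedModule ℝ (E i)]
  [AddCommGroup F] [Lattice F] [IsOrderedAddMonoid F] [Module ℝ F] [IsOrderedModule ℝ F]

/-- For fixed `(x_1'', …, x_m'')`, the functional
`y' ↦ (x̄_{ρ(m)}'' ∘ ⋯ ∘ x̄_{ρ(1)}'') (y' ∘ A)` on `F^~`. -/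
def arensFunctional (ρ : Equiv.Perm (Fin m)) (A : RegularMultilinear E F)
    (x'' : ∀ i, RieszDual (RieszDual (E i))) : RieszDual F →ₗ[ℝ] ℝ where
  toFun y' := barIterate m (fun k => E (ρ k)) (permuteForm ρ (dualComp E F A y'))
    (fun k => x'' (ρ k))
  map_add' y z := by simp only [map_add, _root_.add_apply]
  map_smul' c y := by simp only [map_smul, _root_.smul_apply, RingHom.id_apply]

theorem permuteForm_nonneg (ρ : Equiv.Perm (Fin m)) {B : RegularMultilinear E ℝ}
    (hB : IsPositiveMultilinear B.1) : IsPositiveMultilinear (permuteForm ρ B).1 := by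
  intro y hy
  have h1 : y = fun k => (Equiv.piCongrLeft' E ρ.symm).symm y (ρ k) :=
    ((Equiv.piCongrLeft' E ρ.symm).apply_symm_apply y).symm
  rw [h1, permuteForm_apply]
  refine hB _ fun i => ?_
  obtain ⟨k, rfl⟩ := ρ.surjective i
  rw [← congrFun h1 k]
  exact hy k

theorem arensFunctional_mem (ρ : Equiv.Perm (Fin m)) (A : RegularMultilinear E F)
    (x'' : ∀ i, RieszDual (RieszDual (E i))) :
    arensFunctional ρ A x'' ∈ orderBoundedFunctionals (RieszDual F) := by
  obtain ⟨P, N, hPN, h⟩ := barIterate_regular m (fun k => E (ρ k)) (fun k => x'' (ρ k))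
  obtain ⟨A₁, A₂, h1, h2, hA⟩ := A.2
  let a₁ : RegularMultilinear E F := ⟨A₁, h1.isRegular⟩
  let a₂ : RegularMultilinear E F := ⟨A₂, h2.isRegular⟩
  have hsub : A = a₁ - a₂ := Subtype.ext hA
  have hcomp : ∀ y', dualComp E F A y' = dualComp E F a₁ y' - dualComp E F a₂ y' := by
    intro y'
    rw [hsub]
    exact Subtype.ext (MultilinearMap.ext fun x => y'.toLinearMap.map_sub (A₁ x) (A₂ x))
  let T₁ := (permuteForm (E := E) ρ).comp (dualComp E F a₁)
  let T₂ := (permuteForm (E := E) ρ).comp (dualComp E F a₂)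
  have hT₁ : ∀ y', 0 ≤ y' → IsPositiveMultilinear (T₁ y').1 := fun y' hy =>
    permuteForm_nonneg ρ (B := dualComp E F a₁ y') fun x hx => hy _ (h1 x hx)
  have hT₂ : ∀ y', 0 ≤ y' → IsPositiveMultilinear (T₂ y').1 := fun y' hy =>
    permuteForm_nonneg ρ (B := dualComp E F a₂ y') fun x hx => hy _ (h2 x hx)
  have heq : arensFunctional ρ A x''
      = (P.comp T₁ + N.comp T₂) - (P.comp T₂ + N.comp T₁) := by
    refine LinearMap.ext fun y' => ?_
    change barIterate m (fun k => E (ρ k)) (permuteForm ρ (dualComp E F A y'))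
      (fun k => x'' (ρ k)) = (P (T₁ y') + N (T₂ y')) - (P (T₂ y') + N (T₁ y'))
    have h3 : permuteForm ρ (dualComp E F A y') = T₁ y' - T₂ y' := by
      rw [hcomp]
      exact map_sub (permuteForm ρ) _ _
    have h4 : ∀ Q : RegularMultilinear (fun k => E (ρ k)) ℝ →ₗ[ℝ] ℝ,
        Q (T₁ y' - T₂ y') = Q (T₁ y') - Q (T₂ y') := fun Q => map_sub Q _ _
    rw [h, h3, h4, h4]
    ring
  rw [heq]
  refine Submodule.sub_mem _ (RieszDual.mem_of_nonneg fun y' hy => ?_)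
    (RieszDual.mem_of_nonneg fun y' hy => ?_)
  · exact add_nonneg (hPN _ (hT₁ y' hy)).1 (hPN _ (hT₂ y' hy)).2
  · exact add_nonneg (hPN _ (hT₂ y' hy)).1 (hPN _ (hT₁ y' hy)).2

/-- The Arens extension `AR_m^ρ(A) : E_1^~~ × ⋯ × E_m^~~ → F^~~` of a regular `m`-linear operator
`A`, with `AR_m^ρ(A)(x_1'', …, x_m'')(y') = (x̄_{ρ(m)}'' ∘ ⋯ ∘ x̄_{ρ(1)}'') (y' ∘ A)`. -/
def arensExtension (ρ : Equiv.Perm (Fin m)) (A : RegularMultilinear E F) :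
    MultilinearMap ℝ (fun i => RieszDual (RieszDual (E i))) (RieszDual (RieszDual F)) :=
  MultilinearMap.mk' (fun x'' => ⟨arensFunctional ρ A x'', arensFunctional_mem ρ A x''⟩)
    (by
      intro x'' i v w
      obtain ⟨k, rfl⟩ := ρ.surjective i
      refine RieszDual.ext fun y' => ?_
      change barIterate m (fun k => E (ρ k)) _ (fun l => Function.update x'' (ρ k) (v + w) (ρ l))
        = barIterate m (fun k => E (ρ k)) _ (fun l => Function.update x'' (ρ k) v (ρ l))
        + barIterate m (fun k => E (ρ k)) _ (fun l => Function.update x'' (ρ k) w (ρ l))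
      rw [Function.update_comp_eq_of_injective' x'' ρ.injective k (v + w),
        Function.update_comp_eq_of_injective' x'' ρ.injective k v,
        Function.update_comp_eq_of_injective' x'' ρ.injective k w]
      exact MultilinearMap.map_update_add _ _ _ _ _)
    (by
      intro x'' i c v
      obtain ⟨k, rfl⟩ := ρ.surjective i
      refine RieszDual.ext fun y' => ?_
      change barIterate m (fun k => E (ρ k)) _ (fun l => Function.update x'' (ρ k) (c • v) (ρ l))
        = c * barIterate m (fun k => E (ρ k)) _ (fun l => Function.update x'' (ρ k) v (ρ l))
      rw [Function.update_comp_eq_of_injective' x'' ρ.injective k (c • v),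
        Function.update_comp_eq_of_injective' x'' ρ.injective k v]
      exact MultilinearMap.map_update_smul _ _ _ _ _)

theorem arensExtension_apply (ρ : Equiv.Perm (Fin m)) (A : RegularMultilinear E F)
    (x'' : ∀ i, RieszDual (RieszDual (E i))) (y' : RieszDual F) :
    arensExtension ρ A x'' y'
      = barIterate m (fun k => E (ρ k)) (permuteForm ρ (dualComp E F A y'))
        (fun k => x'' (ρ k)) := rfl

end ArensExtension

end RieszDefs

/-! ### Evaluation at functionals that preserve absolute values -/

section RieszHomFunctionals

variable {E : Type*} [AddCommGroup E] [Lattice E] [IsOrderedAddMonoid E]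
  [Module ℝ E] [IsOrderedModule ℝ E]

/-! Everything rests on one fact about a functional `f` with `f |x| = |f x|`: a functional `g` with
`0 ≤ g ≤ f` vanishes on the kernel of `f`, hence is `c • f` with `c` in `[0, 1]`. By the
Riesz-Kantorovich formula, evaluation at `f` is then compatible with positive parts and absolute
values on the second order dual (`RieszDual.abs_apply_of_abs_apply`).

Since `y'` is a Riesz homomorphism, the form `B = y' ∘ A` satisfies `|B x| = B |x|`. Its slices at
positive values of the other variables are functionals of the above kind, and every slice at `y`
with `|y| ≤ w` is a multiple of the slice at `w`. Any two slices are therefore multiples of a common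
one, on which `z` and `|z|` agree up to sign. So a single sign serves for all slices: the bar
operators of `z` and `|z|` agree on `B` up to sign (`barOperator_eq_or_eq_neg`). The form obtained
from `|z|` again satisfies the absolute value identity (`barOperator_abs_abs_apply`), so an
induction on the number of variables applies, each sign disappearing under the outer absolute value
(`abs_barIterate_apply`). A last evaluation at `y'` moves the absolute value from the second dual of
`F` to the reals. -/

theorem IsRieszHom.abs_apply {F : Type*} [AddCommGroup F] [Lattice F] [Module ℝ F]
    {f : E →ₗ[ℝ] F} (hf : IsRieszHom f) (x : E) : f |x| = |f x| := by
  change f (x ⊔ -x) = f x ⊔ -f x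
  rw [hf.1, map_neg]

/-- A functional that satisfies `f |x| = |f x|` spans the ideal that it generates. -/
theorem exists_eq_smul_of_abs_le {f : E →ₗ[ℝ] ℝ} (hf : ∀ x, f |x| = |f x|)
    {g : E → ℝ} (hg : IsLinearMap ℝ g) (h : ∀ x, |g x| ≤ f |x|) : ∃ c : ℝ, ∀ x, g x = c * f x := by
  have hker : ∀ x, f x = 0 → g x = 0 := fun x hx => by
    have h1 := h x
    rw [hf, hx, abs_zero] at h1
    exact abs_nonpos_iff.1 h1
  by_cases h0 : ∀ x, f x = 0
  · exact ⟨0, fun x => by rw [hker x (h0 x), zero_mul]⟩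
  · push Not at h0
    obtain ⟨u, hu⟩ := h0
    refine ⟨g u / f u, fun x => ?_⟩
    -- The projection of `x` along `u` onto the kernel of `f`, on which `g` vanishes too.
    have h1 := hker (x - (f x / f u) • u) (by
      rw [map_sub, map_smul, smul_eq_mul, div_mul_cancel₀ _ hu, sub_self])
    rw [hg.map_sub, hg.map_smul, smul_eq_mul] at h1
    rw [sub_eq_zero.1 h1]
    ring

namespace RieszDual

theorem nonneg_of_abs_apply {f : RieszDual E} (hf : ∀ x, f |x| = |f x|) : 0 ≤ f := by
  intro x hx
  rw [zero_apply, ← abs_of_nonneg hx, hf]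
  exact abs_nonneg _

/-- By Riesz-Kantorovich the left side is the supremum of `z g` over `0 ≤ g ≤ f`. Each such `g` is
`c • f` with `0 ≤ c ≤ 1`, so no value exceeds `(z f)⁺`; the choices `g = f` and `g = 0` give the
other inequality. -/
theorem posPart_apply_of_abs_apply {f : RieszDual E} (hf : ∀ x, f |x| = |f x|)
    (z : RieszDual (RieszDual E)) : z⁺ f = (z f)⁺ := by
  have hf0 := nonneg_of_abs_apply hf
  have hz : z⁺ = z.pos := by
    change (z - 0).pos + 0 = z.pos
    rw [sub_zero, add_zero]
  rw [hz, z.pos_apply hf0]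
  refine le_antisymm (z.coneSup_le hf0 fun g hg0 hgf => ?_)
    (sup_le (z.le_coneSup hf0 le_rfl) (z.coneSup_nonneg hf0))
  -- Positivity of `g` gives `|g x| ≤ g |x|`, and `g ≤ f` does the rest.
  have habs : ∀ x, |g x| ≤ f |x| := fun x => by
    have h1 := hg0 _ (posPart_nonneg x)
    have h2 := hg0 _ (negPart_nonneg x)
    rw [zero_apply] at h1 h2
    refine le_trans ?_ (hgf |x| (abs_nonneg x))
    rw [← posPart_add_negPart x, map_add, ← abs_of_nonneg h1, ← abs_of_nonneg h2]
    conv_lhs => rw [← posPart_sub_negPart x, map_sub]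
    exact abs_sub _ _
  obtain ⟨c, hc⟩ := exists_eq_smul_of_abs_le (f := f.toLinearMap) hf g.toLinearMap.isLinear habs
  -- If `f` vanishes, nothing constrains `c`, but then `g = 0`. Otherwise a positive `u` with `f u >
  -- 0` forces `0 ≤ c ≤ 1`.
  by_cases h0 : ∀ x, 0 ≤ x → f x ≤ 0
  · have hg : g = 0 := le_antisymm (hgf.trans h0) hg0
    rw [hg, map_zero]
    exact posPart_nonneg _
  · push Not at h0
    obtain ⟨u, hu, hfu⟩ := h0
    have hgu : g u = c * f u := hc u
    have h1 : 0 ≤ g u := hg0 u hu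
    have h2 : g u ≤ f u := hgf u hu
    have hc0 : 0 ≤ c := by
      by_contra hneg
      nlinarith
    have hc1 : c ≤ 1 := by
      by_contra hgt
      nlinarith
    have hgc : g = c • f := ext hc
    rw [hgc, map_smul, smul_eq_mul]
    calc c * z f ≤ c * (z f)⁺ := mul_le_mul_of_nonneg_left (le_posPart _) hc0
      _ ≤ 1 * (z f)⁺ := mul_le_mul_of_nonneg_right hc1 (posPart_nonneg _)
      _ = (z f)⁺ := one_mul _

/-- Evaluation at a Riesz homomorphism preserves absolute values. -/
theorem abs_apply_of_abs_apply {f : RieszDual E} (hf : ∀ x, f |x| = |f x|)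
    (z : RieszDual (RieszDual E)) : |z| f = |z f| := by
  have h : z⁻ f = (z f)⁻ := by
    rw [← posPart_neg, posPart_apply_of_abs_apply hf, neg_apply, posPart_neg]
  rw [← posPart_add_negPart z, add_apply, posPart_apply_of_abs_apply hf, h, posPart_add_negPart]

end RieszDual

end RieszHomFunctionals

/-! ### Positivity and monotonicity of multilinear operators -/

theorem isPositiveMultilinear_of_abs_apply {ι : Type*} {E : ι → Type*} {F : Type*}
    [∀ i, AddCommGroup (E i)] [∀ i, Lattice (E i)] [∀ i, IsOrderedAddMonoid (E i)]
    [∀ i, Module ℝ (E i)]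
    [AddCommGroup F] [Lattice F] [IsOrderedAddMonoid F] [Module ℝ F]
    {A : MultilinearMap ℝ E F} (hA : ∀ x, |A x| = A fun i => |x i|) :
    IsPositiveMultilinear A := fun x hx => by
  have h : (fun i => |x i|) = x := funext fun i => abs_of_nonneg (hx i)
  have h1 := hA x
  rw [h] at h1
  rw [← h1]
  exact abs_nonneg _

/-- The coordinates of `x` are replaced by those of `y` one at a time; each replacement adds the
value of `A` at a positive tuple whose `j`-th entry is `y j - x j`. -/
theorem IsPositiveMultilinear.mono {ι : Type*} [Fintype ι] {E : ι → Type*} {F : Type*}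
    [∀ i, AddCommGroup (E i)] [∀ i, Lattice (E i)] [∀ i, IsOrderedAddMonoid (E i)]
    [∀ i, Module ℝ (E i)]
    [AddCommGroup F] [Lattice F] [IsOrderedAddMonoid F] [Module ℝ F]
    {A : MultilinearMap ℝ E F} (hA : IsPositiveMultilinear A) {x y : ∀ i, E i}
    (hx : ∀ i, 0 ≤ x i) (hxy : ∀ i, x i ≤ y i) : A x ≤ A y := by
  classical
  suffices h : ∀ s : Finset ι, A x ≤ A (s.piecewise y x) by
    simpa using h Finset.univ
  intro s
  induction s using Finset.induction_on with
  | empty => simp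
  | insert j s hj ih =>
    refine ih.trans ?_
    rw [Finset.piecewise_insert, ← sub_nonneg]
    -- Both tuples become updates of the same one at `j`, so that linearity in that variable
    -- applies.
    conv_rhs => rw [← Function.update_eq_self j (s.piecewise y x)]
    rw [Function.update_idem, ← MultilinearMap.map_update_sub]
    refine hA _ fun i => ?_
    rcases eq_or_ne i j with rfl | hij
    · rw [Function.update_self, Finset.piecewise_eq_of_notMem _ _ _ hj]
      exact sub_nonneg.2 (hxy i)
    · rw [Function.update_of_ne hij]
      exact Finset.piecewise_cases s y x (0 ≤ ·) ((hx i).trans (hxy i)) (hx i)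

/-! ### Slices of a form and one bar operator -/

section BarOperator

variable {n : ℕ} {E : Fin (n + 1) → Type*}
  [∀ i, AddCommGroup (E i)] [∀ i, Lattice (E i)] [∀ i, IsOrderedAddMonoid (E i)]
  [∀ i, Module ℝ (E i)] [∀ i, IsOrderedModule ℝ (E i)]

theorem abs_comp_cons (t : E 0) (y : ∀ i : Fin n, E i.succ) :
    (fun i => |(Fin.cons t y : ∀ i, E i) i|) = Fin.cons (α := E) |t| fun i => |y i| := by
  funext i
  refine Fin.cases ?_ (fun j => ?_) i <;> simp

variable {B : RegularMultilinear E ℝ}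

/-- Slices at positive tuples are the functionals to which `RieszDual.abs_apply_of_abs_apply`
applies. -/
theorem partialForm_abs_apply (hB : ∀ x, |B.1 x| = B.1 fun i => |x i|)
    {y : ∀ i : Fin n, E i.succ} (hy : ∀ i, 0 ≤ y i) (t : E 0) :
    partialForm B y |t| = |partialForm B y t| := by
  rw [partialForm_apply, partialForm_apply, hB, abs_comp_cons]
  congr 2
  exact funext fun i => (abs_of_nonneg (hy i)).symm

theorem abs_partialForm_apply (hB : ∀ x, |B.1 x| = B.1 fun i => |x i|)
    (y : ∀ i : Fin n, E i.succ) (t : E 0) :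
    |partialForm B y t| = partialForm B (fun i => |y i|) |t| := by
  rw [partialForm_apply, partialForm_apply, hB, abs_comp_cons]

/-- The slice at `y` is dominated by the slice at `w`, by monotonicity of `B`. Allowing any `w`
above `|y|`, not only `|y|` itself, lets two slices be compared with a common one. -/
theorem exists_partialForm_eq_smul (hB : ∀ x, |B.1 x| = B.1 fun i => |x i|)
    {y w : ∀ i : Fin n, E i.succ} (hyw : ∀ i, |y i| ≤ w i) :
    ∃ c : ℝ, partialForm B y = c • partialForm B w := by
  have hw : ∀ i, 0 ≤ w i := fun i => (abs_nonneg _).trans (hyw i)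
  have hpos := isPositiveMultilinear_of_abs_apply hB
  obtain ⟨c, hc⟩ := exists_eq_smul_of_abs_le (f := (partialForm B w).toLinearMap)
    (partialForm_abs_apply hB hw) (partialForm B y).toLinearMap.isLinear fun t => by
      change |partialForm B y t| ≤ partialForm B w |t|
      rw [abs_partialForm_apply hB]
      refine hpos.mono (fun i => ?_) fun i => ?_
      · exact Fin.cases (by simp) (fun j => by simp) i
      · exact Fin.cases (by simp) (fun j => by simpa using hyw j) i
  exact ⟨c, RieszDual.ext hc⟩

/-- The slices at `y` and `|y|` differ only by a sign, and at the slice for `|y|` the absolute value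
can be moved from `z` to its value. -/
theorem abs_barOperator_apply (hB : ∀ x, |B.1 x| = B.1 fun i => |x i|)
    (z : RieszDual (RieszDual (E 0))) (y : ∀ i : Fin n, E i.succ) :
    |(barOperator z B).1 y| = (barOperator |z| B).1 fun i => |y i| := by
  have hy := fun i => abs_nonneg (y i)
  have habs := partialForm_abs_apply hB hy
  rw [barOperator_apply, barOperator_apply, RieszDual.abs_apply_of_abs_apply habs]
  have hsign : partialForm B y = partialForm B (fun i => |y i|) ∨
      partialForm B y = -partialForm B (fun i => |y i|) := by
    obtain ⟨c, hc⟩ := exists_partialForm_eq_smul hB (y := y) (w := fun i => |y i|)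
      fun i => le_rfl
    -- A zero slice at `|y|` makes both slices zero and either sign works; otherwise comparing
    -- absolute values at a point where it is nonzero gives `|c| = 1`.
    by_cases h0 : ∀ t, 0 ≤ t → partialForm B (fun i => |y i|) t = 0
    · have h1 : partialForm B (fun i => |y i|) = 0 :=
        le_antisymm (fun t ht => (h0 t ht).le) fun t ht => (h0 t ht).ge
      left
      rw [hc, h1, smul_zero]
    · push Not at h0
      obtain ⟨t, ht, ht0⟩ := h0
      have h1 := abs_partialForm_apply hB y t
      rw [habs t, hc, RieszDual.smul_apply, abs_mul] at h1
      have h2 : |c| = 1 := mul_right_cancel₀ (abs_ne_zero.2 ht0) (h1.trans (one_mul _).symm)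
      rcases eq_or_eq_neg_of_abs_eq h2 with rfl | rfl
      · left
        rw [hc, one_smul]
      · right
        rw [hc, neg_smul, one_smul]
  rcases hsign with h | h <;> rw [h]
  rw [map_neg, abs_neg]

/-- The hypothesis on `B` is inherited by the form with one variable fewer, which is what the
induction in `abs_barIterate_apply` needs. -/
theorem barOperator_abs_abs_apply (hB : ∀ x, |B.1 x| = B.1 fun i => |x i|)
    (z : RieszDual (RieszDual (E 0))) (y : ∀ i : Fin n, E i.succ) :
    |(barOperator |z| B).1 y| = (barOperator |z| B).1 fun i => |y i| := by
  rw [abs_barOperator_apply hB, abs_abs]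

/-- The point is that the sign does not depend on the remaining variables. If `y` excluded one sign
and `w` the other, the slice at `|y| + |w|`, of which both slices are multiples, would exclude both;
yet there `|z|` takes the absolute value of what `z` takes. -/
theorem barOperator_eq_or_eq_neg (hB : ∀ x, |B.1 x| = B.1 fun i => |x i|)
    (z : RieszDual (RieszDual (E 0))) :
    barOperator z B = barOperator |z| B ∨ barOperator z B = -barOperator |z| B := by
  by_contra! hne
  obtain ⟨⟨y, hy⟩, w, hw⟩ : (∃ y, z (partialForm B y) ≠ |z| (partialForm B y)) ∧
      ∃ w, z (partialForm B w) ≠ -|z| (partialForm B w) := by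
    constructor
    · by_contra! h
      exact hne.1 (Subtype.ext (MultilinearMap.ext h))
    · by_contra! h
      exact hne.2 (Subtype.ext (MultilinearMap.ext h))
  obtain ⟨c, hc⟩ := exists_partialForm_eq_smul hB (y := y) (w := fun i => |y i| + |w i|)
    fun i => le_add_of_nonneg_right (abs_nonneg _)
  obtain ⟨d, hd⟩ := exists_partialForm_eq_smul hB (y := w) (w := fun i => |y i| + |w i|)
    fun i => le_add_of_nonneg_left (abs_nonneg _)
  have habs := RieszDual.abs_apply_of_abs_apply (partialForm_abs_apply hB
    fun i => add_nonneg (abs_nonneg (y i)) (abs_nonneg (w i))) z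
  rw [hc, map_smul, map_smul, habs, smul_eq_mul, smul_eq_mul] at hy
  rw [hd, map_smul, map_smul, habs, smul_eq_mul, smul_eq_mul] at hw
  rcases abs_choice (z (partialForm B fun i => |y i| + |w i|)) with h | h
  · exact hy (by rw [h])
  · exact hw (by rw [h]; ring)

end BarOperator

/-! ### Iterated bar operators and permutation of variables -/

theorem abs_barIterate_apply (n : ℕ) (E : Fin n → Type*)
    [∀ i, AddCommGroup (E i)] [∀ i, Lattice (E i)] [∀ i, IsOrderedAddMonoid (E i)]
    [∀ i, Module ℝ (E i)] [∀ i, IsOrderedModule ℝ (E i)]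
    {B : RegularMultilinear E ℝ} (hB : ∀ x, |B.1 x| = B.1 fun i => |x i|)
    (x : ∀ i, RieszDual (RieszDual (E i))) :
    |barIterate n E B x| = barIterate n E B fun i => |x i| := by
  induction n with
  | zero =>
    rw [barIterate_zero, barIterate_zero, hB]
    exact congrArg B.1 (funext fun i => i.elim0)
  | succ n ih =>
    rw [barIterate_succ, barIterate_succ,
      -- The induction hypothesis is used for the form produced by `|x 0|`; what remains compares it
      -- with the form produced by `x 0`, under an absolute value that absorbs the sign.
      ← ih _ (barOperator_abs_abs_apply hB (x 0)) fun i => x i.succ]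
    rcases barOperator_eq_or_eq_neg hB (x 0) with h | h
    · rw [h]
    · have h1 := (barIterate n fun i => E i.succ).map_neg (barOperator |x 0| B)
      rw [h, h1, _root_.neg_apply, abs_neg]

theorem abs_permuteForm_apply {ι : Type*} {E : ι → Type*}
    [∀ i, AddCommGroup (E i)] [∀ i, Lattice (E i)] [∀ i, IsOrderedAddMonoid (E i)]
    [∀ i, Module ℝ (E i)] [∀ i, IsOrderedModule ℝ (E i)] (ρ : Equiv.Perm ι)
    {B : RegularMultilinear E ℝ} (hB : ∀ x, |B.1 x| = B.1 fun i => |x i|)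
    (y : ∀ k, E (ρ k)) :
    |(permuteForm ρ B).1 y| = (permuteForm ρ B).1 fun k => |y k| := by
  obtain ⟨x, rfl⟩ : ∃ x : ∀ i, E i, (fun k => x (ρ k)) = y :=
    ⟨(Equiv.piCongrLeft' E ρ.symm).symm y, (Equiv.piCongrLeft' E ρ.symm).apply_symm_apply y⟩
  rw [permuteForm_apply, hB, ← permuteForm_apply ρ B]


/-! ### The Arens extension -/

theorem proposition3p3 {m : ℕ} {E : Fin m → Type*} {F : Type*}
    [∀ i, AddCommGroup (E i)] [∀ i, Lattice (E i)] [∀ i, IsOrderedAddMonoid (E i)]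
    [∀ i, Module ℝ (E i)] [∀ i, IsOrderedModule ℝ (E i)]
    [AddCommGroup F] [Lattice F] [IsOrderedAddMonoid F] [Module ℝ F] [IsOrderedModule ℝ F]
    (A : RegularMultilinear E F) (hA : IsRieszMultimorphism (A : MultilinearMap ℝ E F))
    (ρ : Equiv.Perm (Fin m))
    (y' : RieszDual F) (hy' : IsRieszHom y'.toLinearMap) :
    IsRieszMultimorphism
      ((RieszDual.canonicalMap y').toLinearMap.compMultilinearMap (arensExtension ρ A)) ∧
    ∀ x'' : ∀ i, RieszDual (RieszDual (E i)),
      |arensExtension ρ A x''| y' = arensExtension ρ A (fun i => |x'' i|) y' := by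
  have hyabs : ∀ x, y' |x| = |y' x| := hy'.abs_apply
  have hB : ∀ x, |(dualComp E F A y').1 x| = (dualComp E F A y').1 fun i => |x i| := fun x => by
    change |y' (A.1 x)| = y' (A.1 fun i => |x i|)
    rw [← hA.2 x, hyabs]
  have key : ∀ x'' : ∀ i, RieszDual (RieszDual (E i)),
      |arensExtension ρ A x'' y'| = arensExtension ρ A (fun i => |x'' i|) y' := fun x'' =>
    abs_barIterate_apply m (fun k => E (ρ k)) (abs_permuteForm_apply ρ hB) fun k => x'' (ρ k)
  -- Regularity comes for free: the absolute value identity already forces positivity.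
  refine ⟨⟨(isPositiveMultilinear_of_abs_apply key).isRegular, key⟩, fun x'' => ?_⟩
  -- Here the absolute value is taken in the second dual of `F`; since `y'` preserves absolute
  -- values, it passes to the real value at `y'`.
  rw [RieszDual.abs_apply_of_abs_apply hyabs, key]
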